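/- Let $f(x)=f_0x^m+\dots+f_m$ and $g(x)=g_0x^{m+1}+\dots+g_{m+1}$ be polynomials over $\mathbb{C}$ with $m\ge 1$, $f_0\ne 0$, $g_0\neq 0$, and consider the Liénard system $x'=y$, $y'=-f(x)y-g(x)$. A polynomial $F\in\mathbb{C}[x,y]\setminus\mathbb{C}$ is called an invariant algebraic curve of this system if $yF_x-(f(x)y+g(x))F_y=\lambda F$ for some $\lambda\in\mathbb{C}[x,y]$. For a polynomial $W$ in $y$ whose coefficients are Laurent series at $x=\infty$ (finitely many positive powers of $x$), let $\{W\}_+\in\mathbb{C}[x,y]$ denote its polynomial part, obtained by dropping the negative powers of $x$. Then there are a polynomial $$q(x)=-\frac{f_0}{m+1}x^{m+1}+\sum_{l=1}^{m}q_lx^l ,$$ a Laurent series of type (II), $z(x)=-\frac{g_0}{f_0}x+\sum_{l=0}^{\infty}d_lx^{-l}$, and polynomials $E_n\in\mathbb{C}[t]$ ($n\ge 1$), all depending only on $f$ and $g$, such that the following holds. 1. The series $z$ is the unique series of the form $-\frac{g_0}{f_0}x+\sum_{l\ge0}d'_lx^{-l}$ that solves $yy_x+f(x)y+g(x)=0$.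 2. If a series $\tilde q(x)+\sum_{l\ge0}c_lx^{-l}$, with $\tilde q(x)=-\frac{f_0}{m+1}x^{m+1}+\sum_{l=1}^{m}\tilde q_lx^l$, solves $yy_x+f(x)y+g(x)=0$, then $\tilde q=q$ and $c_n=E_n(c_0)$ for all $n\ge1$. 3. For every irreducible invariant algebraic curve $F$ there are $N\in\mathbb{N}$ (with $N\geq 1$), $k\in\{0,1\}$, a constant $a\in\mathbb{C}\setminus\{0\}$ and series of type (I), $y_j(x)=q(x)+\sum_{l=0}^{\infty}c^{(j)}_lx^{-l}$ for $1\le j\le N-k$, each solving $yy_x+f(x)y+g(x)=0$, such that $$F(x,y)=a\left\{\prod_{j=1}^{N-k}\bigl(y-y_j(x)\bigr)\,\bigl(y-z(x)\bigr)^k\right\}_+ ,$$ where the product over $j$ is $1$ if $N=k=1$; the equality holds already before the polynomial part is taken. The coefficients $c_0^{(1)},\dots,c_0^{(N-k)}$ are pairwise distinct, and $c^{(j)}_n=E_n(c^{(j)}_0)$ for all $n\ge1$ and all $j$. -/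

import Mathlib

open Polynomial
open scoped Polynomial.Bivariate

namespace Lienard

/-! Polynomials in `ℂ[x, y]` are elements of `ℂ[X][Y]`: the inner variable is `x`,
the outer variable is `y`. -/

/-- The partial derivative `∂F/∂x`: differentiate every coefficient `F_n(x)` of `y ^ n`. -/
noncomputable def partialX (F : ℂ[X][Y]) : ℂ[X][Y] :=
  F.sum fun n a => monomial n (derivative a)

theorem coeff_partialX (F : ℂ[X][Y]) (n : ℕ) :
    (partialX F).coeff n = derivative (F.coeff n) := by
  rw [partialX, Polynomial.sum_def, finsetSum_coeff]
  simp only [coeff_monomial]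
  rw [Finset.sum_ite_eq']
  split_ifs with h
  · rfl
  · rw [notMem_support_iff.mp h, derivative_zero]

/-- The partial derivative `∂F/∂y`. -/
noncomputable def partialY (F : ℂ[X][Y]) : ℂ[X][Y] :=
  derivative F

/-- `F ∈ ℂ[x, y] \ ℂ` is an invariant algebraic curve (Darboux polynomial) of the system
`x' = P(x, y)`, `y' = Q(x, y)`: there is a cofactor `L ∈ ℂ[x, y]` with
`P F_x + Q F_y = L F`. -/
def IsInvariantCurve (P Q F : ℂ[X][Y]) : Prop :=
  (∀ a : ℂ, F ≠ C (C a)) ∧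
    ∃ L : ℂ[X][Y], P * partialX F + Q * partialY F = L * F

/-- Invariant algebraic curves of the Liénard system `x' = y`, `y' = -f(x) y - g(x)`. -/
def IsLienardCurve (f g : ℂ[X]) (F : ℂ[X][Y]) : Prop :=
  IsInvariantCurve Y (-(C f * Y) - C g) F

/-- Formal Laurent series at `x = ∞`, i.e. `∑ a_l x ^ (-l)` with finitely many nonnegative
powers of `x`, as Laurent series in the local parameter `1 / x`. -/
abbrev SeriesAtInfinity : Type := LaurentSeries ℂ

/-- The element `x`, which is the inverse of the local parameter. -/
noncomputable def xInf : SeriesAtInfinity := HahnSeries.single (-1 : ℤ) (1 : ℂ)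

/-- The inclusion of `ℂ[x]` into the Laurent series at `x = ∞`. -/
noncomputable def ofPoly : ℂ[X] →+* SeriesAtInfinity :=
  eval₂RingHom (HahnSeries.C : ℂ →+* SeriesAtInfinity) xInf

/-- The series `∑_{l ≥ 0} c_l x ^ (-l)`. -/
noncomputable def tailSeries (c : ℕ → ℂ) : SeriesAtInfinity :=
  HahnSeries.ofPowerSeries ℤ ℂ (PowerSeries.mk c)

/-- The derivation `d/dx`; in terms of `t = 1 / x` it is `-t ^ 2 d/dt`. -/
noncomputable def derivX (y : SeriesAtInfinity) : SeriesAtInfinity :=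
  -(HahnSeries.single (2 : ℤ) (1 : ℂ) * LaurentSeries.derivative ℂ y)

/-- The series `y(x)` solves the equation `y y_x + f(x) y + g(x) = 0` of the orbits of the
Liénard system. -/
def IsOrbitSeries (f g : ℂ[X]) (y : SeriesAtInfinity) : Prop :=
  y * derivX y + ofPoly f * y + ofPoly g = 0

/-- `q = -f₀ / (m + 1) x ^ (m + 1) + ∑_{l = 1}^{m} q_l x ^ l`, where `f₀` is the leading
coefficient of `f` and `m = deg f`. -/
def IsLeadingPoly (f q : ℂ[X]) : Prop :=
  q.natDegree ≤ f.natDegree + 1 ∧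
    q.coeff (f.natDegree + 1) = -f.leadingCoeff / ((f.natDegree : ℂ) + 1) ∧
    q.coeff 0 = 0

/-- A series of type (I): `q(x) + ∑_{l ≥ 0} c_l x ^ (-l)`. -/
noncomputable def seriesI (q : ℂ[X]) (c : ℕ → ℂ) : SeriesAtInfinity :=
  ofPoly q + tailSeries c

/-- A series of type (II): `-(g₀ / f₀) x + ∑_{l ≥ 0} c_l x ^ (-l)`, where `f₀`, `g₀` are the
leading coefficients of `f` and `g`. -/
noncomputable def seriesII (f g : ℂ[X]) (c : ℕ → ℂ) : SeriesAtInfinity :=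
  HahnSeries.C (-(g.leadingCoeff / f.leadingCoeff)) * xInf + tailSeries c

/-- The part of a Laurent series at `x = ∞` with nonnegative powers of `x`. -/
noncomputable def polyPartCoeff (w : SeriesAtInfinity) : ℂ[X] :=
  ∑ p ∈ Finset.range ((-w.order).toNat + 1), monomial p (w.coeff (-(p : ℤ)))

theorem coeff_polyPartCoeff (w : SeriesAtInfinity) (p : ℕ) :
    (polyPartCoeff w).coeff p = w.coeff (-(p : ℤ)) := by
  rw [polyPartCoeff, finsetSum_coeff]
  simp only [coeff_monomial]
  rw [Finset.sum_ite_eq']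
  split_ifs with h
  · rfl
  · symm
    apply HahnSeries.coeff_eq_zero_of_lt_order
    rw [Finset.mem_range] at h
    omega

/-- The polynomial part `{W(x, y)}_+ ∈ ℂ[x, y]` of a polynomial `W` in `y` whose coefficients
are Laurent series at `x = ∞`. -/
noncomputable def polyPart (W : SeriesAtInfinity[X]) : ℂ[X][Y] :=
  W.sum fun n w => monomial n (polyPartCoeff w)

theorem coeff_polyPart (W : SeriesAtInfinity[X]) (n : ℕ) :
    (polyPart W).coeff n = polyPartCoeff (W.coeff n) := by
  rw [polyPart, Polynomial.sum_def, finsetSum_coeff]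
  simp only [coeff_monomial]
  rw [Finset.sum_ite_eq']
  split_ifs with h
  · rfl
  · rw [notMem_support_iff.mp h]
    ext p
    simp [coeff_polyPartCoeff]

/-- The product `∏_j (y - y_j(x)) ⬝ (y - z(x)) ^ k`. -/
noncomputable def branchProduct {n : ℕ} (y : Fin n → SeriesAtInfinity) (z : SeriesAtInfinity)
    (k : ℕ) : SeriesAtInfinity[X] :=
  (∏ j, (X - C (y j))) * (X - C z) ^ k

end Lienard

namespace Lienard

/-! Everything is read off from orders in `t = 1 / x`. Comparing degrees in `y`
(`IsLienardCurve.exists_cofactor`) shows that an invariant curve `F` has constant leading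
coefficient in `y` and a cofactor `w` in `x` alone. Hence along an orbit series `y` the series `h =
F(x, y(x))` satisfies `y h' = w h` (`mul_deriv_eval_eq`), which ties the orders of `y`, `w` and `h`
together.

The series `z` of type (II) has at most a simple pole, so either `F(x, z) = 0` or `w` has no pole.
In the second case shift `y` by `q`, where `q' + f` is the constant `b = slope f g`. The pole of
`q`, of order `m + 1`, dominates the eigenvector equation of the shifted polynomial `P`. So the
coefficients of `P` are regular (`vanishBelow_coeff_shifted`), and the coefficient of `x ^ m` in `b
q + g`, the only obstruction to series of type (I), vanishes (`coeff_eq_zero_of_shifted`). Every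
`c₀` then starts such a series; take for `c₀` a root of `P` at `x = ∞`. Now `h` has positive order,
and `h ≠ 0` would force a pole of `w`, so the series is a root of `F` (`exists_root_seriesI`).
Removing a root leaves an eigenvector, so `F` splits by induction; irreducibility makes the roots
distinct.

The series themselves are fixed points of contractions of power series. Solving for type (I) with
`c₀` an indeterminate yields the polynomials `E` (`exists_universal_tail`). -/

/-! ### Derivation and orders of Laurent series at infinity -/

theorem coeff_derivX (y : SeriesAtInfinity) (n : ℤ) :
    (derivX y).coeff n = -((n : ℂ) - 1) * y.coeff (n - 1) := by
  rw [derivX, HahnSeries.coeff_neg, HahnSeries.coeff_single_mul, LaurentSeries.derivative_apply,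
    LaurentSeries.hasseDeriv_coeff]
  have h : n - 2 + ((1 : ℕ) : ℤ) = n - 1 := by push_cast; ring
  rw [h, Ring.choose_one_right]
  simp only [zsmul_eq_mul, Int.cast_sub, Int.cast_one]
  ring

/-- The Euler operator `t d/dt = -x d/dx`. -/
noncomputable def eulerOp (y : SeriesAtInfinity) : SeriesAtInfinity :=
  HahnSeries.single (1 : ℤ) (1 : ℂ) * LaurentSeries.derivative ℂ y

theorem coeff_eulerOp (y : SeriesAtInfinity) (n : ℤ) :
    (eulerOp y).coeff n = (n : ℂ) * y.coeff n := by
  rw [eulerOp, HahnSeries.coeff_single_mul, LaurentSeries.derivative_apply,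
    LaurentSeries.hasseDeriv_coeff]
  have h : n - 1 + ((1 : ℕ) : ℤ) = n := by push_cast; ring
  rw [h, Ring.choose_one_right]
  simp

/-- The Euler operator multiplies each coefficient by its index without shifting, so the Leibniz
rule is `i + j = n` in each term of the convolution. -/
theorem eulerOp_mul (a b : SeriesAtInfinity) :
    eulerOp (a * b) = a * eulerOp b + b * eulerOp a := by
  have hs : ∀ y : SeriesAtInfinity, (eulerOp y).support ⊆ y.support := by
    intro y n hn
    rw [HahnSeries.mem_support, coeff_eulerOp] at hn
    exact right_ne_zero_of_mul hn
  ext n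
  rw [mul_comm b, HahnSeries.coeff_add, coeff_eulerOp, HahnSeries.coeff_mul,
    HahnSeries.coeff_mul_left' a.isPWO_support (hs a),
    HahnSeries.coeff_mul_right' b.isPWO_support (hs b), Finset.mul_sum, ← Finset.sum_add_distrib]
  refine Finset.sum_congr rfl fun ij hij => ?_
  rw [Finset.mem_antidiagonal] at hij
  rw [coeff_eulerOp, coeff_eulerOp, ← hij.2.2]
  push_cast
  ring

theorem derivX_eq (y : SeriesAtInfinity) :
    derivX y = -(HahnSeries.single (1 : ℤ) (1 : ℂ) * eulerOp y) := by
  rw [derivX, eulerOp, ← mul_assoc, HahnSeries.single_mul_single]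
  norm_num

theorem derivX_add (a b : SeriesAtInfinity) : derivX (a + b) = derivX a + derivX b := by
  simp only [derivX, map_add]; ring

theorem derivX_mul (a b : SeriesAtInfinity) : derivX (a * b) = a * derivX b + b * derivX a := by
  simp only [derivX_eq, eulerOp_mul]; ring

/-- The differential ring structure given by an additive map satisfying the Leibniz rule. -/
@[reducible] noncomputable def differentialOfLeibniz {K : Type*} [CommRing K] (d : K → K)
    (hadd : ∀ a b, d (a + b) = d a + d b) (hmul : ∀ a b, d (a * b) = a * d b + b * d a) :
    Differential K where
  deriv := Derivation.mk' (AddMonoidHom.mk' d hadd).toIntLinearMap hmul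

/-- `d/dx` makes the Laurent series at infinity a differential field. -/
noncomputable instance : Differential SeriesAtInfinity :=
  differentialOfLeibniz derivX derivX_add derivX_mul

theorem derivX_C (a : ℂ) : derivX (HahnSeries.C a) = 0 := by
  ext n
  rw [coeff_derivX, HahnSeries.C_apply, HahnSeries.coeff_single]
  split_ifs with h
  · rw [sub_eq_zero] at h; simp [h]
  · simp

/-- Power series in the local parameter `1 / x` as Laurent series at infinity. -/
noncomputable abbrev ofPS : PowerSeries ℂ →+* SeriesAtInfinity := HahnSeries.ofPowerSeries ℤ ℂ

theorem ofPS_injective : Function.Injective ofPS := HahnSeries.ofPowerSeries_injective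

theorem coeff_ofPS_natCast (a : PowerSeries ℂ) (n : ℕ) :
    (ofPS a).coeff (n : ℤ) = PowerSeries.coeff n a :=
  HahnSeries.ofPowerSeries_apply_coeff a n

theorem coeff_ofPS_of_neg (a : PowerSeries ℂ) {n : ℤ} (hn : n < 0) : (ofPS a).coeff n = 0 := by
  rw [show (ofPS a) = ((a : PowerSeries ℂ) : LaurentSeries ℂ) from rfl, PowerSeries.coeff_coe,
    if_pos hn]

/-- The coefficients of `t ^ k` with `k < n` vanish; here `t = 1 / x`. -/
def VanishBelow (n : ℤ) (w : SeriesAtInfinity) : Prop := ∀ k < n, w.coeff k = 0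

theorem VanishBelow.mono {n k : ℤ} {w : SeriesAtInfinity} (h : VanishBelow n w) (hk : k ≤ n) :
    VanishBelow k w := fun j hj => h j (hj.trans_le hk)

theorem VanishBelow.derivX {n : ℤ} {w : SeriesAtInfinity} (h : VanishBelow n w) :
    VanishBelow (n + 1) (derivX w) := fun j hj => by
  rw [coeff_derivX, h _ (by omega), mul_zero]

/-- Only the pair of lowest terms contributes. The order arguments below compare leading
coefficients in this way. -/
theorem VanishBelow.coeff_mul {n k : ℤ} {a b : SeriesAtInfinity} (ha : VanishBelow n a)
    (hb : VanishBelow k b) : (a * b).coeff (n + k) = a.coeff n * b.coeff k := by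
  rw [HahnSeries.coeff_mul]
  have : ∀ ij ∈ Finset.antidiagonal a.isPWO_support b.isPWO_support (n + k), ij = (n, k) := by
    rintro ⟨i, j⟩ hij
    rw [Finset.mem_antidiagonal] at hij
    obtain ⟨h1, h2, h3⟩ := hij
    have h4 : ¬ i < n := fun h => h1 (ha i h)
    have h5 : ¬ j < k := fun h => h2 (hb j h)
    simp only at h3
    ext <;> simp <;> omega
  rw [Finset.sum_subset (s₂ := {(n, k)})]
  · simp
  · intro ij hij; simpa using this ij hij
  · rintro ⟨i, j⟩ h1 h2
    rw [Finset.mem_singleton] at h1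
    obtain ⟨rfl, rfl⟩ := Prod.mk.inj h1
    by_contra h
    exact h2 (Finset.mem_antidiagonal.2 ⟨left_ne_zero_of_mul h, right_ne_zero_of_mul h, rfl⟩)

theorem VanishBelow.mul {n k : ℤ} {a b : SeriesAtInfinity} (ha : VanishBelow n a)
    (hb : VanishBelow k b) : VanishBelow (n + k) (a * b) := by
  intro j hj
  rw [HahnSeries.coeff_mul]
  refine Finset.sum_eq_zero fun ⟨i, l⟩ hil => ?_
  rw [Finset.mem_antidiagonal] at hil
  obtain ⟨h1, h2, h3⟩ := hil
  have h4 : ¬ i < n := fun h => h1 (ha i h)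
  have h5 : ¬ l < k := fun h => h2 (hb l h)
  simp only at h3
  omega

theorem VanishBelow.add {n : ℤ} {a b : SeriesAtInfinity} (ha : VanishBelow n a)
    (hb : VanishBelow n b) : VanishBelow n (a + b) := fun j hj => by
  rw [HahnSeries.coeff_add, ha j hj, hb j hj, add_zero]

theorem VanishBelow.neg {n : ℤ} {a : SeriesAtInfinity} (ha : VanishBelow n a) :
    VanishBelow n (-a) := fun j hj => by
  rw [HahnSeries.coeff_neg, ha j hj, neg_zero]

theorem vanishBelow_ofPS (a : PowerSeries ℂ) : VanishBelow 0 (ofPS a) :=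
  fun _ hk => coeff_ofPS_of_neg a hk

theorem vanishBelow_C (a : ℂ) : VanishBelow 0 (HahnSeries.C a) := by
  rw [← HahnSeries.ofPowerSeries_C]; exact vanishBelow_ofPS _

theorem VanishBelow.exists_ofPS {w : SeriesAtInfinity} (h : VanishBelow 0 w) :
    ∃ a : PowerSeries ℂ, ofPS a = w := by
  refine ⟨PowerSeries.mk fun n => w.coeff n, ?_⟩
  ext n
  obtain hn | hn := lt_or_ge n 0
  · rw [coeff_ofPS_of_neg _ hn, h n hn]
  · lift n to ℕ using hn
    rw [coeff_ofPS_natCast, PowerSeries.coeff_mk]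

/-- Either a series vanishes or it has a nonzero leading term. -/
theorem exists_leading {w : SeriesAtInfinity} (hw : w ≠ 0) :
    ∃ n, VanishBelow n w ∧ w.coeff n ≠ 0 :=
  ⟨w.order, fun _ hk => HahnSeries.coeff_eq_zero_of_lt_order hk,
    by rwa [Ne, HahnSeries.coeff_order_eq_zero]⟩

/-- If `y dh/dx = w h`, where `y` has a pole of order `k` and `h` has a zero or a pole, the order of
the factor `w` is `1 - k`. -/
theorem coeff_ne_zero_of_mul_derivX_eq {y w h : SeriesAtInfinity} {k n l : ℤ}
    (hy : VanishBelow k y) (hyk : y.coeff k ≠ 0) (hh : VanishBelow n h) (hhn : h.coeff n ≠ 0)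
    (hn : n ≠ 0) (hw : VanishBelow l w) (e : y * derivX h = w * h) : l ≤ k + 1 := by
  by_contra! hl
  have h1 : (y * derivX h).coeff (k + (n + 1)) = y.coeff k * (derivX h).coeff (n + 1) :=
    hy.coeff_mul hh.derivX
  rw [e, hw.mul hh _ (by omega), coeff_derivX, add_sub_cancel_right] at h1
  have : (n : ℂ) ≠ 0 := by exact_mod_cast hn
  push_cast at h1
  rw [add_sub_cancel_right] at h1
  exact (mul_ne_zero hyk (mul_ne_zero (neg_ne_zero.2 this) hhn)) h1.symm

/-- If `y dh/dx = w h` with `h ≠ 0`, then `w` has order at least `1 + ord y`. -/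
theorem vanishBelow_of_mul_derivX_eq {y w h : SeriesAtInfinity} {k : ℤ}
    (hy : VanishBelow k y) (hh : h ≠ 0) (e : y * derivX h = w * h) : VanishBelow (k + 1) w := by
  obtain ⟨n, hn, hn'⟩ := exists_leading hh
  rcases eq_or_ne w 0 with rfl | hw
  · intro j _; simp
  obtain ⟨l, hl, hl'⟩ := exists_leading hw
  refine hl.mono ?_
  by_contra! hlt
  have h1 := hl.coeff_mul hn
  rw [← e, hy.mul hn.derivX _ (by omega)] at h1
  exact mul_ne_zero hl' hn' h1.symm

/-! ### Contractions, and reduction to power series -/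

/-- A map of power series which is contracting for the `X`-adic topology has exactly one fixed
point. -/
theorem existsUnique_fixedPoint {R : Type*} [CommRing R] (Φ : PowerSeries R → PowerSeries R)
    (hΦ : ∀ n a b, PowerSeries.X ^ n ∣ a - b → PowerSeries.X ^ (n + 1) ∣ Φ a - Φ b) :
    ∃! a, Φ a = a := by
  have key : ∀ a b : PowerSeries R, (∀ n, PowerSeries.X ^ n ∣ a - b) → a = b := by
    intro a b h
    ext n
    have := PowerSeries.X_pow_dvd_iff.1 (h (n + 1)) n (Nat.lt_succ_self n)
    rwa [map_sub, sub_eq_zero] at this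
  have hstep : ∀ n k, PowerSeries.X ^ n ∣ Φ^[n + k] 0 - Φ^[n] 0 := by
    intro n
    induction n with
    | zero => intro k; simp
    | succ n ih =>
      intro k
      rw [Nat.add_right_comm, Function.iterate_succ_apply', Function.iterate_succ_apply']
      exact hΦ _ _ _ (ih k)
  -- Coefficient `n` no longer changes after `n + 1` iterations.
  let a : PowerSeries R := PowerSeries.mk fun n => PowerSeries.coeff n (Φ^[n + 1] 0)
  have ha : ∀ n, PowerSeries.X ^ n ∣ a - Φ^[n] 0 := by
    intro n
    rw [PowerSeries.X_pow_dvd_iff]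
    intro i hi
    obtain ⟨k, rfl⟩ := Nat.exists_eq_add_of_le (Nat.succ_le_of_lt hi)
    have := PowerSeries.X_pow_dvd_iff.1 (hstep (i + 1) k) i (Nat.lt_succ_self i)
    rw [map_sub, sub_eq_zero] at this
    rw [map_sub, PowerSeries.coeff_mk, this, sub_self]
  refine ⟨a, key _ _ fun n => ?_, fun c hc => key _ _ fun n => ?_⟩
  · cases n with
    | zero => simp
    | succ n =>
      have h1 := hΦ _ _ _ (ha n)
      have h2 := ha (n + 1)
      rw [Function.iterate_succ_apply'] at h2
      simpa using dvd_sub h1 h2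
  · have hfix : Φ a = a := key _ _ fun n => by
      cases n with
      | zero => simp
      | succ n =>
        have h1 := hΦ _ _ _ (ha n)
        have h2 := ha (n + 1)
        rw [Function.iterate_succ_apply'] at h2
        simpa using dvd_sub h1 h2
    induction n with
    | zero => simp
    | succ n ih => simpa [hc, hfix] using hΦ _ _ _ ih

theorem ofPoly_monomial (n : ℕ) (a : ℂ) :
    ofPoly (monomial n a) = HahnSeries.single (-(n : ℤ)) a := by
  rw [ofPoly, coe_eval₂RingHom, eval₂_monomial, xInf, HahnSeries.single_pow, HahnSeries.C_apply,
    HahnSeries.single_mul_single]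
  simp

theorem ofPoly_C (a : ℂ) : ofPoly (C a) = HahnSeries.C a := by
  rw [ofPoly, coe_eval₂RingHom, eval₂_C]

theorem coeff_ofPoly (p : ℂ[X]) (n : ℕ) : (ofPoly p).coeff (-(n : ℤ)) = p.coeff n := by
  induction p using Polynomial.induction_on' with
  | add p q hp hq => rw [map_add, HahnSeries.coeff_add, hp, hq, coeff_add]
  | monomial k a =>
    rw [ofPoly_monomial, HahnSeries.coeff_single, coeff_monomial]
    simp only [neg_inj, Nat.cast_inj, eq_comm]

theorem vanishBelow_ofPoly {p : ℂ[X]} {n : ℕ} (hp : p.natDegree ≤ n) :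
    VanishBelow (-(n : ℤ)) (ofPoly p) := by
  intro k hk
  have h := coeff_ofPoly p (-k).toNat
  rw [show -(((-k).toNat : ℕ) : ℤ) = k by omega] at h
  rw [h, coeff_eq_zero_of_natDegree_lt (by omega)]

theorem ofPoly_injective : Function.Injective ofPoly := fun p q h => by
  ext n
  rw [← coeff_ofPoly, h, coeff_ofPoly]

theorem derivX_ofPoly (p : ℂ[X]) : derivX (ofPoly p) = ofPoly (derivative p) := by
  induction p using Polynomial.induction_on' with
  | add p q hp hq => rw [map_add, derivX_add, hp, hq, derivative_add, map_add]
  | monomial k a =>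
    ext n
    rw [derivative_monomial, ofPoly_monomial, ofPoly_monomial, coeff_derivX,
      HahnSeries.coeff_single, HahnSeries.coeff_single]
    rcases k with _ | k
    · simp only [Nat.cast_zero, mul_zero, ite_self, neg_zero]
      split_ifs with h
      · have : (n : ℂ) - 1 = 0 := by exact_mod_cast h
        rw [this]; ring
      · simp
    · rw [show (n - 1 = -((k + 1 : ℕ) : ℤ)) = (n = -((k + 1 - 1 : ℕ) : ℤ)) by
        rw [Nat.add_sub_cancel]; push_cast; exact propext ⟨by omega, by omega⟩]
      split_ifs with h
      · rw [h, Nat.add_sub_cancel]; push_cast; ring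
      · simp

theorem xInf_mul_ofPS_X : xInf * ofPS PowerSeries.X = 1 := by
  rw [ofPS, HahnSeries.ofPowerSeries_X, xInf, HahnSeries.single_mul_single]
  simp

theorem xInf_pow_mul_ofPS_X_pow (n : ℕ) : xInf ^ n * ofPS PowerSeries.X ^ n = 1 := by
  rw [← mul_pow, xInf_mul_ofPS_X, one_pow]

theorem xInf_ne_zero : xInf ≠ 0 := left_ne_zero_of_mul_eq_one xInf_mul_ofPS_X

theorem coeff_xInf_pow_mul (n : ℕ) (w : SeriesAtInfinity) (k : ℤ) :
    (xInf ^ n * w).coeff k = w.coeff (k + n) := by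
  rw [xInf, HahnSeries.single_pow, HahnSeries.coeff_single_mul]
  simp

/-- Clears the pole, so that the orbit equation becomes one between power series in `1 / x`. -/
theorem exists_ofPoly_eq {p : ℂ[X]} {n : ℕ} (hp : p.natDegree ≤ n) :
    ∃ P : PowerSeries ℂ,
      ofPoly p = xInf ^ n * ofPS P ∧ PowerSeries.constantCoeff P = p.coeff n := by
  have h0 : VanishBelow 0 (ofPS PowerSeries.X ^ n * ofPoly p) := by
    intro k hk
    have h1 := coeff_xInf_pow_mul n (ofPS PowerSeries.X ^ n * ofPoly p) (k - n)
    rw [← mul_assoc, xInf_pow_mul_ofPS_X_pow, one_mul, sub_add_cancel] at h1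
    rw [← h1, vanishBelow_ofPoly hp _ (by omega)]
  obtain ⟨P, hP⟩ := h0.exists_ofPS
  have h1 : ofPoly p = xInf ^ n * ofPS P := by
    rw [hP, ← mul_assoc, xInf_pow_mul_ofPS_X_pow, one_mul]
  refine ⟨P, h1, ?_⟩
  rw [← coeff_ofPoly, h1, coeff_xInf_pow_mul, neg_add_cancel,
    ← PowerSeries.coeff_zero_eq_constantCoeff_apply]
  exact (coeff_ofPS_natCast P 0).symm

theorem derivX_ofPS (a : PowerSeries ℂ) :
    derivX (ofPS a) = -ofPS (PowerSeries.X * (PowerSeries.X * PowerSeries.derivative ℂ a)) := by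
  ext n
  rw [coeff_derivX, HahnSeries.coeff_neg]
  obtain hn | hn := lt_or_ge n 0
  · rw [coeff_ofPS_of_neg _ hn, coeff_ofPS_of_neg _ (by omega)]; simp
  lift n to ℕ using hn
  rw [coeff_ofPS_natCast]
  rcases n with _ | n
  · rw [coeff_ofPS_of_neg _ (by simp)]; simp
  rw [PowerSeries.coeff_succ_X_mul, show ((n + 1 : ℕ) : ℤ) - 1 = n by push_cast; ring,
    coeff_ofPS_natCast]
  rcases n with _ | n
  · simp
  rw [PowerSeries.coeff_succ_X_mul, PowerSeries.coeff_derivative]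
  push_cast
  ring

theorem derivX_xInf : derivX xInf = 1 := by
  have h : xInf = ofPoly X := by rw [ofPoly, coe_eval₂RingHom, eval₂_X]
  rw [h, derivX_ofPoly, derivative_X, map_one]

theorem tailSeries_eq (c : ℕ → ℂ) : tailSeries c = ofPS (PowerSeries.mk c) := rfl

theorem mk_injective {c c' : ℕ → ℂ} (h : PowerSeries.mk c = PowerSeries.mk c') : c = c' := by
  funext n
  rw [← PowerSeries.coeff_mk n c, h, PowerSeries.coeff_mk]

/-- Unlike `d/dX`, the operator `X d/dX` does not lower the `X`-adic order, which keeps the maps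
below contracting. -/
theorem X_pow_dvd_X_mul_derivative_sub {R : Type*} [CommRing R] {n : ℕ} {a b : PowerSeries R}
    (h : PowerSeries.X ^ n ∣ a - b) :
    PowerSeries.X ^ n ∣
      PowerSeries.X * PowerSeries.derivative R a - PowerSeries.X * PowerSeries.derivative R b := by
  rw [← mul_sub, ← map_sub, PowerSeries.X_pow_dvd_iff]
  rw [PowerSeries.X_pow_dvd_iff] at h
  intro i hi
  rcases i with _ | i
  · simp
  · rw [PowerSeries.coeff_succ_X_mul, PowerSeries.coeff_derivative, h _ hi, zero_mul]

/-! ### The series of type (II) -/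

/-- The equation for the series of type (II) in terms of power series. -/
theorem isOrbitSeries_xInf_mul_iff {f g : ℂ[X]} {m : ℕ} {φ γ : PowerSeries ℂ}
    (hφ : ofPoly f = xInf ^ m * ofPS φ) (hγ : ofPoly g = xInf ^ (m + 1) * ofPS γ)
    (v : PowerSeries ℂ) :
    IsOrbitSeries f g (xInf * ofPS v) ↔
      PowerSeries.X ^ m * (v * (v - PowerSeries.X * PowerSeries.derivative ℂ v)) +
        φ * v + γ = 0 := by
  have h1 : derivX (xInf * ofPS v) = ofPS (v - PowerSeries.X * PowerSeries.derivative ℂ v) := by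
    rw [derivX_mul, derivX_ofPS, derivX_xInf, map_mul, map_sub]
    linear_combination
      (-ofPS (PowerSeries.X * PowerSeries.derivative ℂ v)) * xInf_mul_ofPS_X
  have h2 : xInf ^ (m + 1) * ofPS (PowerSeries.X ^ m *
      (v * (v - PowerSeries.X * PowerSeries.derivative ℂ v)) + φ * v + γ) =
      xInf * ofPS v * derivX (xInf * ofPS v) + ofPoly f * (xInf * ofPS v) + ofPoly g := by
    rw [h1, hφ, hγ, map_add, map_add, map_mul, map_mul, map_mul, map_pow]
    linear_combination (xInf * ofPS v * ofPS (v - PowerSeries.X * PowerSeries.derivative ℂ v)) *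
      xInf_pow_mul_ofPS_X_pow m
  rw [IsOrbitSeries, ← h2, mul_eq_zero, or_iff_right (pow_ne_zero _ xInf_ne_zero),
    map_eq_zero_iff _ ofPS_injective]

theorem seriesII_eq (f g : ℂ[X]) (d : ℕ → ℂ) :
    seriesII f g d = xInf * ofPS (PowerSeries.C (-(g.leadingCoeff / f.leadingCoeff)) +
      PowerSeries.X * PowerSeries.mk d) := by
  rw [seriesII, tailSeries_eq, map_add, mul_add, map_mul, ← mul_assoc, xInf_mul_ofPS_X, one_mul,
    HahnSeries.ofPowerSeries_C, mul_comm]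

/-- There is exactly one series of type (II). -/
theorem exists_seriesII {f g : ℂ[X]} (hf : 1 ≤ f.natDegree) (hg : g.natDegree = f.natDegree + 1) :
    ∃ d : ℕ → ℂ, ∀ d', IsOrbitSeries f g (seriesII f g d') ↔ d' = d := by
  obtain ⟨φ, hφ, hφ0⟩ := exists_ofPoly_eq (le_refl f.natDegree)
  obtain ⟨γ, hγ, hγ0⟩ := exists_ofPoly_eq hg.le
  rw [coeff_natDegree] at hφ0
  rw [← hg, coeff_natDegree] at hγ0
  have hf0 : f.leadingCoeff ≠ 0 := by
    rw [Ne, leadingCoeff_eq_zero]; rintro rfl; simp at hf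
  have hφφ : φ * φ⁻¹ = 1 := PowerSeries.mul_inv_cancel _ (by rwa [hφ0])
  set m := f.natDegree
  -- The equation solved for `φ * v`: `φ` is a unit because `f₀ ≠ 0`, and `X ^ m` with `m ≥ 1` makes
  -- the map contracting.
  obtain ⟨v, hv, huniq⟩ := existsUnique_fixedPoint
    (fun v => -(φ⁻¹ * (γ + PowerSeries.X ^ m *
      (v * (v - PowerSeries.X * PowerSeries.derivative ℂ v))))) (by
    intro n a b h
    obtain ⟨k, hk⟩ : ∃ k, m = k + 1 := ⟨m - 1, by omega⟩
    have h' := X_pow_dvd_X_mul_derivative_sub h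
    obtain ⟨r, hr⟩ := h
    obtain ⟨s, hs⟩ := h'
    refine ⟨-(φ⁻¹ * PowerSeries.X ^ k * (r * (a - PowerSeries.X * PowerSeries.derivative ℂ a) +
      b * (r - s))), ?_⟩
    rw [hk]
    linear_combination (-φ⁻¹ * PowerSeries.X ^ (k + 1) *
      (a - PowerSeries.X * PowerSeries.derivative ℂ a) - φ⁻¹ * PowerSeries.X ^ (k + 1) * b) * hr +
      φ⁻¹ * PowerSeries.X ^ (k + 1) * b * hs)
  have heq : ∀ w : PowerSeries ℂ, IsOrbitSeries f g (xInf * ofPS w) ↔ w = v := by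
    intro w
    rw [isOrbitSeries_xInf_mul_iff hφ hγ]
    constructor
    · intro h
      apply huniq
      linear_combination (-φ⁻¹) * h + w * hφφ
    · rintro rfl
      linear_combination (-φ) * hv - (γ + PowerSeries.X ^ m *
        (w * (w - PowerSeries.X * PowerSeries.derivative ℂ w))) * hφφ
  have hv0 : PowerSeries.constantCoeff v = -(g.leadingCoeff / f.leadingCoeff) := by
    rw [← hv]
    have : m ≠ 0 := by omega
    simp [hφ0, hγ0, this]
    field_simp
  refine ⟨fun n => PowerSeries.coeff (n + 1) v, fun d' => ?_⟩
  rw [seriesII_eq, heq]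
  have hv' : v = PowerSeries.C (-(g.leadingCoeff / f.leadingCoeff)) +
      PowerSeries.X * PowerSeries.mk fun n => PowerSeries.coeff (n + 1) v := by
    ext n
    rcases n with _ | n
    · simp [hv0]
    · rw [map_add, PowerSeries.coeff_succ_X_mul, PowerSeries.coeff_mk, PowerSeries.coeff_C,
        if_neg (Nat.succ_ne_zero n), zero_add]
  constructor
  · intro h
    rw [hv', add_right_inj] at h
    exact mk_injective (mul_left_cancel₀ PowerSeries.X_ne_zero h)
  · rintro rfl
    exact hv'.symm

/-! ### The series of type (I) -/

/-- The formal inverse of the Euler operator `X d/dX` on series without constant term. -/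
noncomputable def eulerInv {R : Type*} [CommRing R] [Algebra ℂ R] (a : PowerSeries R) :
    PowerSeries R :=
  PowerSeries.mk fun n => algebraMap ℂ R (n : ℂ)⁻¹ * PowerSeries.coeff n a

theorem eulerInv_sub {R : Type*} [CommRing R] [Algebra ℂ R] (a b : PowerSeries R) :
    eulerInv (a - b) = eulerInv a - eulerInv b := by
  ext n; simp [eulerInv, mul_sub]

theorem X_pow_dvd_eulerInv {R : Type*} [CommRing R] [Algebra ℂ R] {a : PowerSeries R} {n : ℕ}
    (h : PowerSeries.X ^ n ∣ a) : PowerSeries.X ^ n ∣ eulerInv a := by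
  rw [PowerSeries.X_pow_dvd_iff] at h ⊢
  intro i hi
  rw [eulerInv, PowerSeries.coeff_mk, h i hi, mul_zero]

/-- Puts the differential equation into fixed-point form. Since `(0 : ℂ)⁻¹ = 0`, `eulerInv a` has no
constant term and the initial value `c` is free. -/
theorem eq_add_eulerInv_iff {R : Type*} [CommRing R] [Algebra ℂ R] (u a : PowerSeries R) (c : R)
    (ha : PowerSeries.constantCoeff a = 0) :
    PowerSeries.C c + eulerInv a = u ↔
      PowerSeries.constantCoeff u = c ∧ PowerSeries.X * PowerSeries.derivative R u = a := by
  have hn : ∀ n : ℕ, algebraMap ℂ R (((n + 1 : ℕ) : ℂ)⁻¹) * ((n : R) + 1) = 1 := fun n => by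
    have : ((n : R) + 1) = algebraMap ℂ R ((n + 1 : ℕ) : ℂ) := by simp
    rw [this, ← map_mul, inv_mul_cancel₀ (by exact_mod_cast Nat.succ_ne_zero n), map_one]
  constructor
  · rintro rfl
    refine ⟨by simp [eulerInv], ?_⟩
    ext n
    rcases n with _ | n
    · simp [ha]
    · rw [PowerSeries.coeff_succ_X_mul, PowerSeries.coeff_derivative, map_add, PowerSeries.coeff_C,
        if_neg (Nat.succ_ne_zero n), zero_add, eulerInv, PowerSeries.coeff_mk]
      linear_combination PowerSeries.coeff (n + 1) a * hn n
  · rintro ⟨rfl, rfl⟩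
    ext n
    rcases n with _ | n
    · simp [eulerInv]
    · rw [map_add, PowerSeries.coeff_C, if_neg (Nat.succ_ne_zero n), zero_add, eulerInv,
        PowerSeries.coeff_mk, PowerSeries.coeff_succ_X_mul, PowerSeries.coeff_derivative]
      linear_combination PowerSeries.coeff (n + 1) u * hn n

/-- The initial value problem for the tail of the series of type (I), with coefficients in an
arbitrary `ℂ`-algebra. -/
theorem existsUnique_tail {R : Type*} [CommRing R] [Algebra ℂ R] {Q S : PowerSeries R} (b c κ : R)
    {m : ℕ} (hm : 1 ≤ m) (hQ : κ * PowerSeries.constantCoeff Q = 1)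
    (hS : PowerSeries.constantCoeff S = 0) :
    ∃! u : PowerSeries R, PowerSeries.constantCoeff u = c ∧
      (Q + PowerSeries.X ^ (m + 1) * u) * (PowerSeries.X * PowerSeries.derivative R u) =
        S + PowerSeries.C b * PowerSeries.X ^ m * u := by
  obtain ⟨k, rfl⟩ : ∃ k, m = k + 1 := ⟨m - 1, by omega⟩
  obtain ⟨Q', hQ'⟩ : PowerSeries.X ∣ Q - PowerSeries.C (PowerSeries.constantCoeff Q) :=
    PowerSeries.X_dvd_iff.2 (by simp)
  have hκ : PowerSeries.C κ * PowerSeries.C (PowerSeries.constantCoeff Q) = 1 := by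
    rw [← map_mul, hQ, map_one]
  -- Isolating the constant term of `Q`, which `κ` inverts, gives `X u' = Ψ u`; in `Ψ` the unknown
  -- occurs only with a factor `X`.
  let Ψ : PowerSeries R → PowerSeries R := fun u =>
    PowerSeries.C κ * (S + PowerSeries.C b * PowerSeries.X ^ (k + 1) * u -
      PowerSeries.X * (Q' + PowerSeries.X ^ (k + 1) * u) *
        (PowerSeries.X * PowerSeries.derivative R u))
  have hΨ0 : ∀ u, PowerSeries.constantCoeff (Ψ u) = 0 := fun u => by simp [Ψ, hS]
  obtain ⟨u, hu, huniq⟩ := existsUnique_fixedPoint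
    (fun u => PowerSeries.C c + eulerInv (Ψ u)) (by
    intro n a e h
    have h' := X_pow_dvd_X_mul_derivative_sub h
    rw [add_sub_add_left_eq_sub, ← eulerInv_sub]
    apply X_pow_dvd_eulerInv
    obtain ⟨r, hr⟩ := h
    obtain ⟨s, hs⟩ := h'
    refine ⟨PowerSeries.C κ * (PowerSeries.C b * PowerSeries.X ^ k * r -
      (Q' + PowerSeries.X ^ (k + 1) * a) * s - PowerSeries.X ^ (k + 1) * r *
        (PowerSeries.X * PowerSeries.derivative R e)), ?_⟩
    simp only [Ψ]
    linear_combination (PowerSeries.C κ * PowerSeries.C b * PowerSeries.X ^ (k + 1) -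
      PowerSeries.C κ * PowerSeries.X * PowerSeries.X ^ (k + 1) *
        (PowerSeries.X * PowerSeries.derivative R e)) * hr -
      PowerSeries.C κ * PowerSeries.X * (Q' + PowerSeries.X ^ (k + 1) * a) * hs)
  have key : ∀ w, PowerSeries.C c + eulerInv (Ψ w) = w ↔ PowerSeries.constantCoeff w = c ∧
      (Q + PowerSeries.X ^ (k + 1 + 1) * w) * (PowerSeries.X * PowerSeries.derivative R w) =
        S + PowerSeries.C b * PowerSeries.X ^ (k + 1) * w := by
    intro w
    rw [eq_add_eulerInv_iff _ _ _ (hΨ0 w)]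
    refine and_congr_right fun _ => ?_
    simp only [Ψ]
    constructor
    · intro h
      linear_combination PowerSeries.C (PowerSeries.constantCoeff Q) * h +
        (PowerSeries.X * PowerSeries.derivative R w) * hQ' + (S + PowerSeries.C b *
        PowerSeries.X ^ (k + 1) * w - PowerSeries.X * (Q' + PowerSeries.X ^ (k + 1) * w) *
        (PowerSeries.X * PowerSeries.derivative R w)) * hκ
    · intro h
      linear_combination PowerSeries.C κ * h - PowerSeries.C κ *
        (PowerSeries.X * PowerSeries.derivative R w) * hQ' -
        (PowerSeries.X * PowerSeries.derivative R w) * hκ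
  exact ⟨u, (key u).1 hu, fun w hw => huniq w ((key w).2 hw)⟩

theorem leadingCoeff_ne_zero_of_one_le {f : ℂ[X]} (hf : 1 ≤ f.natDegree) : f.leadingCoeff ≠ 0 := by
  rw [Ne, leadingCoeff_eq_zero]; rintro rfl; simp at hf

theorem IsLeadingPoly.coeff_ne_zero {f q : ℂ[X]} (hf : 1 ≤ f.natDegree) (hq : IsLeadingPoly f q) :
    q.coeff (f.natDegree + 1) ≠ 0 := by
  rw [hq.2.1]
  exact div_ne_zero (neg_ne_zero.2 (leadingCoeff_ne_zero_of_one_le hf))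
    (Nat.cast_add_one_ne_zero _)

/-- The constant `(m + 1) g₀ / f₀` which equals `dq/dx + f`. -/
noncomputable def slope (f g : ℂ[X]) : ℂ :=
  ((f.natDegree : ℂ) + 1) * g.leadingCoeff / f.leadingCoeff

theorem exists_isLeadingPoly {f : ℂ[X]} (hf : 1 ≤ f.natDegree) (b : ℂ) :
    ∃ q, IsLeadingPoly f q ∧ derivative q = C b - f := by
  let q : ℂ[X] := ∑ l ∈ Finset.range (f.natDegree + 1),
    monomial (l + 1) ((C b - f).coeff l / ((l : ℂ) + 1))
  have hsucc : ∀ l, q.coeff (l + 1) = (C b - f).coeff l / ((l : ℂ) + 1) := by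
    intro l
    simp only [q, finsetSum_coeff, coeff_monomial, add_left_inj, Finset.sum_ite_eq',
      Finset.mem_range]
    split_ifs with h
    · rfl
    · rw [coeff_sub, coeff_C, if_neg (by omega), coeff_eq_zero_of_natDegree_lt (by omega)]
      simp
  refine ⟨q, ⟨?_, ?_, ?_⟩, ?_⟩
  · rw [natDegree_le_iff_coeff_eq_zero]
    intro l hl
    obtain ⟨l, rfl⟩ : ∃ k, l = k + 1 := ⟨l - 1, by omega⟩
    rw [hsucc, coeff_sub, coeff_C, if_neg (by omega), coeff_eq_zero_of_natDegree_lt (by omega)]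
    simp
  · rw [hsucc, coeff_sub, coeff_C, if_neg (by omega), coeff_natDegree, zero_sub]
  · simp [q, coeff_monomial]
  · ext l
    rw [coeff_derivative, hsucc]
    have : (l : ℂ) + 1 ≠ 0 := by exact_mod_cast Nat.succ_ne_zero l
    field_simp

/-- The value of `slope f g` is the one that cancels the terms in `x ^ (m + 1)`. -/
theorem IsLeadingPoly.natDegree_remainder_le {f g q : ℂ[X]} (hf : 1 ≤ f.natDegree)
    (hg : g.natDegree = f.natDegree + 1) (hq : IsLeadingPoly f q) :
    (C (slope f g) * q + g).natDegree ≤ f.natDegree := by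
  rw [natDegree_le_iff_coeff_eq_zero]
  intro n hn
  rw [coeff_add, coeff_C_mul]
  rcases (Nat.succ_le_of_lt hn).eq_or_lt with h | h
  · rw [← h, Nat.succ_eq_add_one, hq.2.1, ← hg, coeff_natDegree, slope]
    have h1 := leadingCoeff_ne_zero_of_one_le hf
    have h2 : (f.natDegree : ℂ) + 1 ≠ 0 := Nat.cast_add_one_ne_zero _
    field_simp
    ring
  · rw [coeff_eq_zero_of_natDegree_lt (hq.1.trans_lt h),
      coeff_eq_zero_of_natDegree_lt (hg.trans_lt h)]
    simp

/-- The polynomial part of a series of type (I) is determined by its derivative. -/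
theorem IsLeadingPoly.derivative_eq {f g q : ℂ[X]} (hf : 1 ≤ f.natDegree)
    (hg : g.natDegree = f.natDegree + 1) (hq : IsLeadingPoly f q) {c : ℕ → ℂ}
    (h : IsOrbitSeries f g (seriesI q c)) : derivative q = C (slope f g) - f := by
  set m := f.natDegree with hm
  set u := PowerSeries.mk c
  have hy : VanishBelow (-((m + 1 : ℕ) : ℤ)) (seriesI q c) :=
    (vanishBelow_ofPoly hq.1).add ((vanishBelow_ofPS u).mono (by omega))
  have hyc : (seriesI q c).coeff (-((m + 1 : ℕ) : ℤ)) = q.coeff (m + 1) := by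
    rw [seriesI, HahnSeries.coeff_add, coeff_ofPoly, tailSeries_eq,
      coeff_ofPS_of_neg _ (by omega), add_zero]
  have hyc0 : q.coeff (m + 1) ≠ 0 := hq.coeff_ne_zero hf
  -- `w = y' + f` equals `-g / y`, a quotient of series with poles of the same order `m + 1`. So it
  -- is regular with constant term `slope f g`, and the tail contributes only negative powers of `x`
  -- to it.
  set w := ofPoly (derivative q + f) + derivX (ofPS u) with hw
  have hmul : seriesI q c * w = -ofPoly g := by
    rw [IsOrbitSeries] at h
    have : derivX (seriesI q c) = ofPoly (derivative q) + derivX (ofPS u) := by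
      rw [seriesI, derivX_add, derivX_ofPoly, tailSeries_eq]
    rw [this] at h
    rw [hw, map_add]
    linear_combination h
  have hgd : VanishBelow (-((m + 1 : ℕ) : ℤ)) (ofPoly g) := vanishBelow_ofPoly hg.le
  have hw0 : VanishBelow 0 w := by
    rcases eq_or_ne w 0 with h0 | h0
    · rw [h0]; intro j _; simp
    obtain ⟨n, hn, hn0⟩ := exists_leading h0
    refine hn.mono ?_
    by_contra! hlt
    have h1 := hy.coeff_mul hn
    rw [hmul, hgd.neg _ (by omega), hyc] at h1
    exact mul_ne_zero hyc0 hn0 h1.symm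
  have hwb : w.coeff 0 = slope f g := by
    have h1 := hy.coeff_mul hw0
    rw [hmul, hyc, add_zero, HahnSeries.coeff_neg, coeff_ofPoly, ← hg, coeff_natDegree, hg,
      hq.2.1] at h1
    have h2 := leadingCoeff_ne_zero_of_one_le hf
    have h3 : (m : ℂ) + 1 ≠ 0 := Nat.cast_add_one_ne_zero _
    rw [← hm] at h1
    rw [slope, ← hm]
    field_simp at h1 ⊢
    linear_combination h1
  have hcoef : ∀ n : ℕ, (derivative q + f).coeff n = w.coeff (-(n : ℤ)) := by
    intro n
    rw [hw, HahnSeries.coeff_add, coeff_ofPoly, (vanishBelow_ofPS u).derivX _ (by omega), add_zero]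
  rw [eq_sub_iff_add_eq]
  ext n
  rw [hcoef, coeff_C]
  split_ifs with h0
  · rw [h0, Nat.cast_zero, neg_zero, hwb]
  · exact hw0 _ (by omega)

theorem IsLeadingPoly.eq_of_derivative_eq {f q q' : ℂ[X]} (hq : IsLeadingPoly f q)
    (hq' : IsLeadingPoly f q') (h : derivative q = derivative q') : q = q' := by
  ext n
  rcases n with _ | n
  · rw [hq.2.2, hq'.2.2]
  · have h1 := congrArg (fun p => p.coeff n) h
    simp only [coeff_derivative] at h1
    exact mul_right_cancel₀ (by exact_mod_cast Nat.succ_ne_zero n) h1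

/-- The equation for the series of type (I) in terms of power series. -/
theorem isOrbitSeries_seriesI_iff {f g q : ℂ[X]} {b : ℂ} {m : ℕ} {Q S : PowerSeries ℂ}
    (hq : derivative q = C b - f) (hQ : ofPoly q = xInf ^ (m + 1) * ofPS Q)
    (hS : ofPoly (C b * q + g) = xInf ^ m * ofPS S) (c : ℕ → ℂ) :
    IsOrbitSeries f g (seriesI q c) ↔
      (Q + PowerSeries.X ^ (m + 1) * PowerSeries.mk c) *
        (PowerSeries.X * PowerSeries.derivative ℂ (PowerSeries.mk c)) =
      S + PowerSeries.C b * PowerSeries.X ^ m * PowerSeries.mk c := by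
  set u := PowerSeries.mk c
  have hf : ofPoly f = HahnSeries.C b - ofPoly (derivative q) := by
    rw [hq, map_sub, ofPoly_C]; ring
  have h1 : xInf ^ m * ofPS ((S + PowerSeries.C b * PowerSeries.X ^ m * u) -
      (Q + PowerSeries.X ^ (m + 1) * u) * (PowerSeries.X * PowerSeries.derivative ℂ u)) =
      seriesI q c * derivX (seriesI q c) + ofPoly f * seriesI q c + ofPoly g := by
    rw [seriesI, derivX_add, derivX_ofPoly, tailSeries_eq, derivX_ofPS, hf]
    rw [map_add, map_mul, ofPoly_C] at hS
    simp only [map_sub, map_add, map_mul, map_pow, HahnSeries.ofPowerSeries_C]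
    linear_combination -hS + (HahnSeries.C b * ofPS u -
      ofPS u * ofPS PowerSeries.X *
        (ofPS PowerSeries.X * ofPS (PowerSeries.derivative ℂ u))) * xInf_pow_mul_ofPS_X_pow m +
      (ofPS PowerSeries.X * (ofPS PowerSeries.X * ofPS (PowerSeries.derivative ℂ u))) * hQ +
      xInf ^ m * ofPS Q * (ofPS PowerSeries.X * ofPS (PowerSeries.derivative ℂ u)) *
        xInf_mul_ofPS_X
  rw [IsOrbitSeries, ← h1, mul_eq_zero, or_iff_right (pow_ne_zero _ xInf_ne_zero),
    map_eq_zero_iff _ ofPS_injective, sub_eq_zero, eq_comm]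

theorem map_derivative_powerSeries {R T : Type*} [CommRing R] [CommRing T] (φ : R →+* T)
    (a : PowerSeries R) :
    PowerSeries.map φ (PowerSeries.derivative R a) =
      PowerSeries.derivative T (PowerSeries.map φ a) := by
  ext n
  simp [PowerSeries.coeff_derivative]

/-- The coefficients of the series of type (I) are universal polynomials in `c₀`, and there is such
a series for every value of `c₀` once the obstruction vanishes. -/
theorem exists_universal_tail {f g q : ℂ[X]} (hf : 1 ≤ f.natDegree)
    (hg : g.natDegree = f.natDegree + 1) (hq : IsLeadingPoly f q)
    (hq' : derivative q = C (slope f g) - f) :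
    ∃ E : ℕ → ℂ[X],
      (∀ c, IsOrbitSeries f g (seriesI q c) → ∀ n, 1 ≤ n → c n = (E n).eval (c 0)) ∧
      ((C (slope f g) * q + g).coeff f.natDegree = 0 →
        ∀ c₀, ∃ c, c 0 = c₀ ∧ IsOrbitSeries f g (seriesI q c)) := by
  obtain ⟨Q, hQ, hQ0⟩ := exists_ofPoly_eq hq.1
  obtain ⟨S, hS, hS0⟩ := exists_ofPoly_eq (hq.natDegree_remainder_le hf hg)
  have heq := isOrbitSeries_seriesI_iff hq' hQ hS
  have hQ1 : (q.coeff (f.natDegree + 1))⁻¹ * PowerSeries.constantCoeff Q = 1 := by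
    rw [hQ0]; exact inv_mul_cancel₀ (hq.coeff_ne_zero hf)
  rw [← hS0]
  set b := slope f g
  set m := f.natDegree
  have hm0 : m ≠ 0 := by omega
  -- As `m ≥ 1`, a solution forces the constant term of `S` to vanish. Otherwise there is no series
  -- of type (I) and any `E` will do.
  by_cases h0 : PowerSeries.constantCoeff S = 0
  swap
  · refine ⟨fun _ => 0, fun c hc => absurd ?_ h0, fun h => absurd h h0⟩
    have := congrArg PowerSeries.constantCoeff ((heq c).1 hc)
    simpa [hm0, eq_comm] using this
  -- Solve over `ℂ[X]` with the indeterminate as initial value. Evaluation at `c₀` gives a solution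
  -- over `ℂ`, and uniqueness there makes the coefficients of `U` universal.
  obtain ⟨U, ⟨hU0, hU⟩, -⟩ := existsUnique_tail (R := ℂ[X]) (Q := PowerSeries.map C Q)
    (S := PowerSeries.map C S) (C b) X (C (q.coeff (m + 1))⁻¹) hf
    (by rw [← PowerSeries.coeff_zero_eq_constantCoeff_apply, PowerSeries.coeff_map,
      PowerSeries.coeff_zero_eq_constantCoeff_apply, ← map_mul, hQ1, map_one])
    (by rw [← PowerSeries.coeff_zero_eq_constantCoeff_apply, PowerSeries.coeff_map,
      PowerSeries.coeff_zero_eq_constantCoeff_apply, h0, map_zero])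
  let c : ℂ → ℕ → ℂ := fun c₀ n => (PowerSeries.coeff n U).eval c₀
  have hmk : ∀ c₀, PowerSeries.mk (c c₀) = PowerSeries.map (evalRingHom c₀) U := by
    intro c₀; ext n; simp [c]
  have hmm : ∀ c₀ (A : PowerSeries ℂ),
      PowerSeries.map (evalRingHom c₀) (PowerSeries.map C A) = A := by
    intro c₀ A; ext n; simp
  have hc0 : ∀ c₀, c c₀ 0 = c₀ := by
    intro c₀
    simp only [c, PowerSeries.coeff_zero_eq_constantCoeff_apply, hU0, eval_X]
  have hc : ∀ c₀, IsOrbitSeries f g (seriesI q (c c₀)) := by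
    intro c₀
    rw [heq, hmk]
    have := congrArg (PowerSeries.map (evalRingHom c₀)) hU
    simpa only [map_mul, map_add, map_pow, PowerSeries.map_X, PowerSeries.map_C, hmm,
      map_derivative_powerSeries, coe_evalRingHom, eval_C] using this
  refine ⟨fun n => PowerSeries.coeff n U, fun c' hc' n _ => ?_, fun _ c₀ => ⟨c c₀, hc0 c₀, hc c₀⟩⟩
  obtain ⟨V, -, hV⟩ := existsUnique_tail (Q := Q) (S := S) b (c' 0) _ hf hQ1 h0
  have h1 := hV (PowerSeries.mk c') ⟨by simp, (heq c').1 hc'⟩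
  have h2 := hV (PowerSeries.mk (c (c' 0))) ⟨by simp [hc0], (heq _).1 (hc _)⟩
  exact congrFun (mk_injective (h1.trans h2.symm)) n

/-! ### The Liénard operator on polynomials in `y` -/

section Operator

variable {K : Type*} [CommRing K] [Differential K]

/-- The operator `y ∂/∂x - (a y + b) ∂/∂y` on polynomials in `y` over a differential ring. -/
noncomputable def lienardOp (a b : K) (F : K[X]) : K[X] :=
  X * Differential.mapCoeffs F - (C a * X + C b) * derivative F

theorem mapCoeffs_mul (F G : K[X]) : Differential.mapCoeffs (F * G) =
    F * Differential.mapCoeffs G + G * Differential.mapCoeffs F := by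
  rw [Derivation.leibniz, smul_eq_mul, smul_eq_mul]

theorem mapCoeffs_X_sub_C (y : K) :
    Differential.mapCoeffs (X - C y) = -C (Differential.deriv y) := by
  rw [map_sub, Differential.mapCoeffs_X, Differential.mapCoeffs_C, zero_sub]

/-- By the orbit equation `X - C y` is itself an eigenvector, with cofactor `-(y' + a)`. The Leibniz
rule then lets a root be divided out of an eigenvector. -/
theorem lienardOp_X_sub_C_mul {a b y : K} (hy : y * Differential.deriv y + a * y + b = 0)
    (H : K[X]) : lienardOp a b ((X - C y) * H) =
      (X - C y) * (lienardOp a b H - C (Differential.deriv y + a) * H) := by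
  have h := congrArg (C : K → K[X]) hy
  simp only [map_add, map_mul, map_zero] at h
  rw [lienardOp, lienardOp, mapCoeffs_mul, mapCoeffs_X_sub_C, derivative_mul, derivative_sub,
    derivative_X, derivative_C, map_add]
  linear_combination (-H) * h

theorem mapCoeffs_comp_X_add_C (F : K[X]) (q : K) :
    Differential.mapCoeffs (F.comp (X + C q)) = (Differential.mapCoeffs F).comp (X + C q) +
      C (Differential.deriv q) * (derivative F).comp (X + C q) := by
  induction F using Polynomial.induction_on' with
  | add F G hF hG => simp only [add_comp, map_add, hF, hG]; ring
  | monomial n a =>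
    rw [monomial_comp, mapCoeffs_mul, Derivation.leibniz_pow, map_add, Differential.mapCoeffs_X,
      Differential.mapCoeffs_C, Differential.mapCoeffs_C, Differential.mapCoeffs_monomial,
      monomial_comp, derivative_monomial, monomial_comp, smul_eq_mul, nsmul_eq_mul, map_mul,
      map_natCast]
    ring

theorem deriv_eval (F : K[X]) (y : K) : Differential.deriv (F.eval y) =
    (Differential.mapCoeffs F).eval y + (derivative F).eval y * Differential.deriv y := by
  induction F using Polynomial.induction_on' with
  | add F G hF hG => simp only [eval_add, map_add, hF, hG]; ring
  | monomial n a =>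
    rw [eval_monomial, Derivation.leibniz, Derivation.leibniz_pow, Differential.mapCoeffs_monomial,
      eval_monomial, derivative_monomial, eval_monomial, smul_eq_mul, smul_eq_mul, smul_eq_mul,
      nsmul_eq_mul]
    ring

theorem mul_deriv_eval_eq {a b y : K} (hy : y * Differential.deriv y + a * y + b = 0) (F : K[X]) :
    y * Differential.deriv (F.eval y) = (lienardOp a b F).eval y := by
  rw [deriv_eval, lienardOp]
  simp only [eval_sub, eval_mul, eval_add, eval_X, eval_C]
  linear_combination ((derivative F).eval y) * hy

/-- When `q' + a` is the constant `b`, the new `∂/∂y` coefficient involves only `b` and the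
remainder `b q + g`, whose pole is of lower order than that of `q`. -/
theorem lienardOp_comp (a b q : K) (F : K[X]) : (lienardOp a b F).comp (X + C q) =
    (X + C q) * Differential.mapCoeffs (F.comp (X + C q)) -
      (C (Differential.deriv q + a) * X + C ((Differential.deriv q + a) * q + b)) *
        derivative (F.comp (X + C q)) := by
  rw [mapCoeffs_comp_X_add_C, lienardOp, derivative_comp]
  simp only [sub_comp, mul_comp, add_comp, X_comp, C_comp, derivative_X,
    derivative_C, map_add, map_mul]
  ring

end Operator

/-! ### Pole estimates for the shifted eigenvector -/

/-- The coefficients in `y` of an eigenvector of the shifted operator. -/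
theorem coeff_shifted_eq {K : Type*} [CommRing K] [Differential K] {Q β r w : K} {P : K[X]}
    (h : (X + C Q) * Differential.mapCoeffs P - (C β * X + C r) * derivative P = C w * P) (i : ℕ) :
    Q * Differential.deriv (P.coeff i) = w * P.coeff i - (X * Differential.mapCoeffs P).coeff i +
      β * (P.coeff i * i) + r * (P.coeff (i + 1) * (i + 1)) := by
  have h1 : C Q * Differential.mapCoeffs P = C w * P - X * Differential.mapCoeffs P +
      C β * (X * derivative P) + C r * derivative P := by
    linear_combination h
  have h2 := congrArg (fun p => p.coeff i) h1
  simp only [coeff_add, coeff_sub, coeff_C_mul, Differential.coeff_mapCoeffs,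
    coeff_derivative] at h2
  rw [h2]
  rcases i with _ | i
  · simp
  · rw [coeff_X_mul (derivative P), coeff_derivative]
    push_cast
    ring

theorem VanishBelow.mul_natCast {n : ℤ} {a : SeriesAtInfinity} (ha : VanishBelow n a) (k : ℕ) :
    VanishBelow n (a * k) := by
  have h : VanishBelow 0 (k : SeriesAtInfinity) := by
    rw [← map_natCast (HahnSeries.C : ℂ →+* SeriesAtInfinity)]; exact vanishBelow_C _
  simpa using ha.mul h

theorem VanishBelow.sub {n : ℤ} {a b : SeriesAtInfinity} (ha : VanishBelow n a)
    (hb : VanishBelow n b) : VanishBelow n (a - b) := by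
  rw [sub_eq_add_neg]; exact ha.add hb.neg

theorem vanishBelow_X_mul_mapCoeffs {P : SeriesAtInfinity[X]} {n : ℤ}
    (h : ∀ i, VanishBelow n (P.coeff i)) (i : ℕ) :
    VanishBelow (n + 1) ((X * Differential.mapCoeffs P).coeff i) := by
  rcases i with _ | i
  · intro j _; simp
  · rw [coeff_X_mul, Differential.coeff_mapCoeffs]; exact (h i).derivX

theorem vanishBelow_shifted_step {Q β r w : SeriesAtInfinity} {P : SeriesAtInfinity[X]} {m : ℕ}
    (hm : 1 ≤ m) (hQ : VanishBelow (-((m + 1 : ℕ) : ℤ)) Q)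
    (hQ0 : Q.coeff (-((m + 1 : ℕ) : ℤ)) ≠ 0) (hβ : VanishBelow 0 β)
    (hr : VanishBelow (-(m : ℤ)) r) (hw : VanishBelow 0 w)
    (h : (X + C Q) * Differential.mapCoeffs P - (C β * X + C r) * derivative P = C w * P)
    {n : ℕ} (hn : 1 ≤ n)
    (hP : ∀ i, VanishBelow (-(n : ℤ)) (P.coeff i)) (i : ℕ) :
    VanishBelow (-(n : ℤ) + 1) (P.coeff i) := by
  -- The term `Q * P_i'` may reach order `-m - n`, and only `r * P_{i+1}` could match it. Descending
  -- induction on `i`, from above the degree, has already improved `P_{i+1}`, so the leading term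
  -- must vanish.
  suffices H : ∀ k i, P.natDegree < i + k → (P.coeff i).coeff (-(n : ℤ)) = 0 by
    intro j hj
    rcases (Int.lt_add_one_iff.1 hj).eq_or_lt with rfl | h1
    · exact H (P.natDegree + 1) i (by omega)
    · exact hP i j h1
  intro k
  induction k with
  | zero => intro i hi; rw [coeff_eq_zero_of_natDegree_lt (by simpa using hi)]; simp
  | succ k ih =>
    intro i hi
    have h1 : VanishBelow (-(n : ℤ) + 1) (P.coeff (i + 1)) := by
      intro j hj
      rcases (Int.lt_add_one_iff.1 hj).eq_or_lt with rfl | h1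
      · exact ih (i + 1) (by omega)
      · exact hP _ j h1
    have h2 := hQ.coeff_mul (hP i).derivX
    have e := coeff_shifted_eq h i
    have h3 : VanishBelow (-(m : ℤ) + (-(n : ℤ) + 1)) (Q * derivX (P.coeff i)) := by
      change VanishBelow _ (Q * Differential.deriv (P.coeff i))
      rw [e]
      refine (((hw.mul (hP i)).mono (by omega)).sub
        ((vanishBelow_X_mul_mapCoeffs hP i).mono (by omega))).add
        ((hβ.mul ((hP i).mul_natCast i)).mono (by omega)) |>.add ?_
      have := hr.mul (h1.mul_natCast (i + 1))
      push_cast at this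
      exact this
    rw [h3 _ (by push_cast; omega), coeff_derivX, add_sub_cancel_right] at h2
    have h4 : ((-(n : ℤ) + 1 : ℤ) : ℂ) - 1 ≠ 0 := by
      push_cast
      have : (n : ℂ) ≠ 0 := by exact_mod_cast (by omega : n ≠ 0)
      simpa using this
    have h5 := (mul_eq_zero.1 h2.symm).resolve_left hQ0
    exact (mul_eq_zero.1 h5).resolve_left (neg_ne_zero.2 h4)

/-- The coefficients of an eigenvector of the shifted operator have no poles at infinity. -/
theorem vanishBelow_coeff_shifted {Q β r w : SeriesAtInfinity} {P : SeriesAtInfinity[X]} {m : ℕ}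
    (hm : 1 ≤ m) (hQ : VanishBelow (-((m + 1 : ℕ) : ℤ)) Q)
    (hQ0 : Q.coeff (-((m + 1 : ℕ) : ℤ)) ≠ 0) (hβ : VanishBelow 0 β)
    (hr : VanishBelow (-(m : ℤ)) r) (hw : VanishBelow 0 w)
    (h : (X + C Q) * Differential.mapCoeffs P - (C β * X + C r) * derivative P = C w * P)
    (i : ℕ) : VanishBelow 0 (P.coeff i) := by
  have key : ∀ n : ℕ, (∀ i, VanishBelow (-(n : ℤ)) (P.coeff i)) →
      ∀ i, VanishBelow 0 (P.coeff i) := by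
    intro n
    induction n with
    | zero => intro h i; simpa using h i
    | succ n ih =>
      intro hn
      apply ih
      intro i
      have := vanishBelow_shifted_step hm hQ hQ0 hβ hr hw h (Nat.succ_le_succ (Nat.zero_le n)) hn i
      exact this.mono (by push_cast; omega)
  refine key (∑ i ∈ Finset.range (P.natDegree + 1), (-(P.coeff i).order).toNat) (fun i => ?_) i
  by_cases hi : i ∈ Finset.range (P.natDegree + 1)
  · have h1 := Finset.single_le_sum (f := fun i => (-(P.coeff i).order).toNat)
      (fun _ _ => Nat.zero_le _) hi
    intro j hj
    exact HahnSeries.coeff_eq_zero_of_lt_order (by omega)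
  · rw [Finset.mem_range] at hi
    rw [coeff_eq_zero_of_natDegree_lt (by omega)]
    intro j _; simp

/-- A nonconstant monic eigenvector of the shifted operator forces the obstruction to vanish. -/
theorem coeff_eq_zero_of_shifted {Q β r w : SeriesAtInfinity} {P : SeriesAtInfinity[X]} {m : ℕ}
    (hm : 1 ≤ m) (hQ : VanishBelow (-((m + 1 : ℕ) : ℤ)) Q)
    (hQ0 : Q.coeff (-((m + 1 : ℕ) : ℤ)) ≠ 0) (hβ : VanishBelow 0 β)
    (hr : VanishBelow (-(m : ℤ)) r) (hw : VanishBelow 0 w)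
    (h : (X + C Q) * Differential.mapCoeffs P - (C β * X + C r) * derivative P = C w * P)
    (hP : P.Monic) (hdeg : P.natDegree ≠ 0) :
    r.coeff (-(m : ℤ)) = 0 := by
  have hv := vanishBelow_coeff_shifted hm hQ hQ0 hβ hr hw h
  obtain ⟨i, hi⟩ := Nat.exists_eq_succ_of_ne_zero hdeg
  have h1 : P.coeff (i + 1) = 1 := by rw [← Nat.succ_eq_add_one, ← hi]; exact hP
  have e := coeff_shifted_eq h i
  -- A derivative has no term in `x⁻¹`, so that of a regular series has order at least 2 and `Q *
  -- P_i'` cannot reach `x ^ m`.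
  have hd : VanishBelow 2 (derivX (P.coeff i)) := by
    intro j hj
    rw [coeff_derivX]
    rcases (show j ≤ 1 by omega).eq_or_lt with rfl | h2
    · simp
    · rw [hv i _ (by omega), mul_zero]
  have e' : r * ((i + 1 : ℕ) : SeriesAtInfinity) = Q * derivX (P.coeff i) - w * P.coeff i +
      (X * Differential.mapCoeffs P).coeff i - β * (P.coeff i * i) := by
    change _ = Q * Differential.deriv (P.coeff i) - w * P.coeff i +
      (X * Differential.mapCoeffs P).coeff i - β * (P.coeff i * i)
    rw [e, h1]
    push_cast
    ring
  have h2 : VanishBelow (-(m : ℤ) + 1) (r * ((i + 1 : ℕ) : SeriesAtInfinity)) := by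
    rw [e']
    exact ((((hQ.mul hd).mono (by push_cast; omega)).sub ((hw.mul (hv i)).mono (by omega))).add
      ((vanishBelow_X_mul_mapCoeffs hv i).mono (by omega))).sub
      ((hβ.mul ((hv i).mul_natCast i)).mono (by omega))
  have h3 := h2 (-(m : ℤ)) (by omega)
  rw [← map_natCast (HahnSeries.C : ℂ →+* SeriesAtInfinity), HahnSeries.C_apply,
    HahnSeries.coeff_mul_single_zero] at h3
  exact (mul_eq_zero.1 h3).resolve_right (by exact_mod_cast Nat.succ_ne_zero i)

/-- A polynomial over the power series takes a value without constant term at a series whose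
constant term is a root of the reduction. -/
theorem vanishBelow_one_eval {P : SeriesAtInfinity[X]} (hP : ∀ i, VanishBelow 0 (P.coeff i))
    {N : ℕ} (hN : N ≠ 0) (hPN : P.coeff N = 1) :
    ∃ c₀ : ℂ, ∀ u : PowerSeries ℂ, PowerSeries.constantCoeff u = c₀ →
      VanishBelow 1 (P.eval (ofPS u)) := by
  obtain ⟨R, hR⟩ : ∃ R : (PowerSeries ℂ)[X], R.map ofPS = P := by
    rw [← mem_lifts, lifts_iff_coeff_lifts]
    exact fun i => (hP i).exists_ofPS
  have hRN : R.coeff N = 1 := by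
    apply ofPS_injective
    rw [← coeff_map, hR, hPN, map_one]
  have hdeg : (R.map PowerSeries.constantCoeff).degree ≠ 0 := by
    intro h0
    have h1 := coeff_eq_zero_of_degree_lt
      (p := R.map (PowerSeries.constantCoeff (R := ℂ))) (n := N)
      (by rw [h0]; exact_mod_cast Nat.pos_of_ne_zero hN)
    rw [coeff_map, hRN, map_one] at h1
    exact one_ne_zero h1
  obtain ⟨c₀, hc₀⟩ := IsAlgClosed.exists_root _ hdeg
  refine ⟨c₀, fun u hu j hj => ?_⟩
  rw [← hR, eval_map, eval₂_hom]
  rcases (show j ≤ 0 by omega).eq_or_lt with rfl | h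
  · have h1 := coeff_ofPS_natCast (R.eval u) 0
    rw [Nat.cast_zero] at h1
    rw [h1, PowerSeries.coeff_zero_eq_constantCoeff_apply, ← eval₂_hom, ← eval_map, hu]
    exact hc₀
  · exact coeff_ofPS_of_neg _ h

/-! ### Splitting into branches -/

theorem vanishBelow_seriesII (f g : ℂ[X]) (d : ℕ → ℂ) : VanishBelow (-1) (seriesII f g d) := by
  rw [seriesII_eq]
  intro k hk
  have := coeff_xInf_pow_mul 1 (ofPS (PowerSeries.C (-(g.leadingCoeff / f.leadingCoeff)) +
      PowerSeries.X * PowerSeries.mk d)) k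
  rw [pow_one] at this
  rw [this, coeff_ofPS_of_neg _ (by push_cast; omega)]

section Roots

variable {f g q : ℂ[X]} {d : ℕ → ℂ}

/-- A monic eigenvector which does not vanish on the series of type (II) vanishes on a series of
type (I). -/
theorem exists_root_seriesI (hf : 1 ≤ f.natDegree) (hg : g.natDegree = f.natDegree + 1)
    (hq : IsLeadingPoly f q) (hq' : derivative q = C (slope f g) - f)
    (hd : IsOrbitSeries f g (seriesII f g d)) {F : SeriesAtInfinity[X]} {w : SeriesAtInfinity}
    (hF : F.Monic) (hdeg : F.natDegree ≠ 0)
    (hop : lienardOp (ofPoly f) (ofPoly g) F = C w * F) (hz : F.eval (seriesII f g d) ≠ 0) :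
    ∃ c, IsOrbitSeries f g (seriesI q c) ∧ F.IsRoot (seriesI q c) := by
  have hev : ∀ y, IsOrbitSeries f g y → y * derivX (F.eval y) = w * F.eval y := by
    intro y hy
    have h1 : y * Differential.deriv (F.eval y) = _ := mul_deriv_eval_eq hy F
    rw [hop, eval_mul, eval_C] at h1
    exact h1
  have hw : VanishBelow 0 w :=
    (vanishBelow_of_mul_derivX_eq (vanishBelow_seriesII f g d) hz (hev _ hd)).mono (by omega)
  have hslope : Differential.deriv (ofPoly q) + ofPoly f = HahnSeries.C (slope f g) := by
    change derivX (ofPoly q) + ofPoly f = _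
    rw [derivX_ofPoly, hq', map_sub, ofPoly_C]; ring
  have hrem : HahnSeries.C (slope f g) * ofPoly q + ofPoly g =
      ofPoly (C (slope f g) * q + g) := by rw [map_add, map_mul, ofPoly_C]
  have hcomp := lienardOp_comp (ofPoly f) (ofPoly g) (ofPoly q) F
  rw [hop, mul_comp, C_comp, hslope, hrem] at hcomp
  have hQ := vanishBelow_ofPoly hq.1
  have hQ0 : (ofPoly q).coeff (-((f.natDegree + 1 : ℕ) : ℤ)) ≠ 0 := by
    rw [coeff_ofPoly]; exact hq.coeff_ne_zero hf
  have hr := vanishBelow_ofPoly (hq.natDegree_remainder_le hf hg)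
  have hP : (F.comp (X + C (ofPoly q))).Monic := hF.comp_X_add_C _
  have hPdeg : (F.comp (X + C (ofPoly q))).natDegree = F.natDegree := by
    rw [natDegree_comp, natDegree_X_add_C, mul_one]
  have h0 := coeff_eq_zero_of_shifted hf hQ hQ0 (vanishBelow_C _) hr hw hcomp.symm hP
    (by rwa [hPdeg])
  have hv := vanishBelow_coeff_shifted hf hQ hQ0 (vanishBelow_C _) hr hw hcomp.symm
  rw [coeff_ofPoly] at h0
  obtain ⟨E, -, hE⟩ := exists_universal_tail hf hg hq hq'
  obtain ⟨c₀, hc₀⟩ := vanishBelow_one_eval hv (by rwa [hPdeg]) hP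
  obtain ⟨c, hc, hcO⟩ := hE h0 c₀
  refine ⟨c, hcO, ?_⟩
  have h1 := hc₀ (PowerSeries.mk c) (by simp [hc])
  rw [eval_comp, eval_add, eval_X, eval_C, add_comm, ← tailSeries_eq] at h1
  change VanishBelow 1 (F.eval (seriesI q c)) at h1
  -- Otherwise `h` has order `n ≥ 1`, and `y h' = w h` with a pole of order `m + 1` in `y` forces a
  -- pole of `w`.
  by_contra hne
  obtain ⟨n, hn, hn0⟩ := exists_leading hne
  have hn1 : 1 ≤ n := by
    by_contra! hlt
    exact hn0 (h1 n hlt)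
  have hy : VanishBelow (-((f.natDegree + 1 : ℕ) : ℤ)) (seriesI q c) :=
    hQ.add ((vanishBelow_ofPS _).mono (by omega))
  have hy0 : (seriesI q c).coeff (-((f.natDegree + 1 : ℕ) : ℤ)) ≠ 0 := by
    rw [seriesI, HahnSeries.coeff_add, tailSeries_eq, coeff_ofPS_of_neg _ (by omega), add_zero]
    exact hQ0
  have := coeff_ne_zero_of_mul_derivX_eq hy hy0 hn hn0 (by omega) hw (hev _ hcO)
  push_cast at this
  omega

/-- A monic eigenvector of the Liénard operator splits over the Laurent series at infinity, with
roots among the series of types (I) and (II). -/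
theorem exists_multiset_roots (hf : 1 ≤ f.natDegree) (hg : g.natDegree = f.natDegree + 1)
    (hq : IsLeadingPoly f q) (hq' : derivative q = C (slope f g) - f)
    (hd : IsOrbitSeries f g (seriesII f g d)) {F : SeriesAtInfinity[X]} {w : SeriesAtInfinity}
    (hF : F.Monic) (hop : lienardOp (ofPoly f) (ofPoly g) F = C w * F) :
    ∃ s : Multiset SeriesAtInfinity, F = (s.map fun y => X - C y).prod ∧
      ∀ y ∈ s, y = seriesII f g d ∨ ∃ c, y = seriesI q c ∧ IsOrbitSeries f g y := by
  induction hN : F.natDegree generalizing F w with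
  | zero => exact ⟨0, by simpa using hF.natDegree_eq_zero.1 hN, by simp⟩
  | succ N ih =>
    obtain ⟨y, hyO, hyroot, hy⟩ : ∃ y, IsOrbitSeries f g y ∧ F.IsRoot y ∧
        (y = seriesII f g d ∨ ∃ c, y = seriesI q c ∧ IsOrbitSeries f g y) := by
      by_cases hz : F.eval (seriesII f g d) = 0
      · exact ⟨_, hd, hz, Or.inl rfl⟩
      · obtain ⟨c, hc, hc'⟩ := exists_root_seriesI hf hg hq hq' hd hF (by omega) hop hz
        exact ⟨_, hc, hc', Or.inr ⟨c, rfl, hc⟩⟩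
    obtain ⟨H, rfl⟩ := dvd_iff_isRoot.2 hyroot
    have hH : H.Monic := (monic_X_sub_C y).of_mul_monic_left hF
    have hHN : H.natDegree = N := by
      rw [(monic_X_sub_C y).natDegree_mul hH, natDegree_X_sub_C] at hN; omega
    have hop' : lienardOp (ofPoly f) (ofPoly g) H =
        C (w + (Differential.deriv y + ofPoly f)) * H := by
      rw [lienardOp_X_sub_C_mul hyO] at hop
      apply mul_left_cancel₀ (X_sub_C_ne_zero y)
      rw [map_add]
      linear_combination hop
    obtain ⟨s, hs, hs'⟩ := ih hH hop' hHN
    refine ⟨y ::ₘ s, by rw [Multiset.map_cons, Multiset.prod_cons, ← hs], ?_⟩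
    intro x hx
    rcases Multiset.mem_cons.1 hx with rfl | hx
    · exact hy
    · exact hs' x hx

end Roots

/-! ### Irreducible invariant curves -/

/-- The leading coefficient in `y` of an invariant curve is constant, and the cofactor depends on
`x` only. -/
theorem IsLienardCurve.exists_cofactor {f g : ℂ[X]} {F : ℂ[X][Y]} (hF : IsLienardCurve f g F) :
    ∃ (μ : ℂ) (w : ℂ[X]), μ ≠ 0 ∧ F.leadingCoeff = C μ ∧ F.natDegree ≠ 0 ∧
      Y * partialX F - (C f * Y + C g) * derivative F = C w * F := by
  obtain ⟨hne, L, hL⟩ := hF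
  rw [partialY] at hL
  have hF0 : F ≠ 0 := by
    have := hne 0
    rwa [map_zero, map_zero] at this
  have hd : (derivative F).natDegree ≤ F.natDegree := natDegree_derivative_le F |>.trans (by omega)
  have hG : ∀ n, F.natDegree ≤ n → (L * F).coeff (n + 1) = derivative (F.coeff n) := by
    intro n hn
    have h0 : (derivative F).coeff n = 0 := by
      rw [coeff_derivative, coeff_eq_zero_of_natDegree_lt (by omega), zero_mul]
    have h1 : (derivative F).coeff (n + 1) = 0 := coeff_eq_zero_of_natDegree_lt (by omega)
    rw [← hL, show (Y * partialX F + (-(C f * Y) - C g) * derivative F) =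
      Y * partialX F - C f * (Y * derivative F) - C g * derivative F by ring]
    simp only [coeff_sub, coeff_C_mul, coeff_X_mul, coeff_partialX, h0, h1, mul_zero, sub_zero]
  have hLdeg : L.natDegree ≤ 1 := by
    by_contra! hlt
    have h1 := hG (L.natDegree + F.natDegree - 1) (by omega)
    rw [Nat.sub_add_cancel (by omega), coeff_mul_degree_add_degree,
      coeff_eq_zero_of_natDegree_lt (n := L.natDegree + F.natDegree - 1) (by omega),
      derivative_zero] at h1
    have hL0 : L ≠ 0 := by rintro rfl; simp at hlt
    exact mul_ne_zero (leadingCoeff_ne_zero.2 hL0) (leadingCoeff_ne_zero.2 hF0) h1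
  have htop : L.coeff 1 * F.leadingCoeff = derivative F.leadingCoeff := by
    rw [← coeff_natDegree, ← hG _ le_rfl, add_comm F.natDegree 1,
      coeff_mul_add_eq_of_natDegree_le hLdeg le_rfl]
  have hlc0 : F.leadingCoeff ≠ 0 := leadingCoeff_ne_zero.2 hF0
  -- The leading coefficient divides its own derivative, which has smaller degree.
  have hder : derivative F.leadingCoeff = 0 :=
    eq_zero_of_dvd_of_degree_lt (Dvd.intro_left _ htop) (degree_derivative_lt hlc0)
  obtain ⟨μ, hμ⟩ : ∃ μ, F.leadingCoeff = C μ :=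
    ⟨_, eq_C_of_natDegree_eq_zero (derivative_eq_zero.1 hder)⟩
  have hL1 : L.coeff 1 = 0 := by
    rw [hder] at htop
    exact (mul_eq_zero.1 htop).resolve_right hlc0
  have hLC : L = C (L.coeff 0) := by
    rw [eq_X_add_C_of_natDegree_le_one hLdeg, hL1]; simp
  refine ⟨μ, L.coeff 0, ?_, hμ, ?_, ?_⟩
  · rintro rfl
    rw [map_zero] at hμ
    exact hlc0 hμ
  · intro h0
    apply hne μ
    rw [← hμ, ← coeff_natDegree, h0]
    exact eq_C_of_natDegree_eq_zero h0
  · rw [← hLC, ← hL]; ring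

theorem map_partialX (F : ℂ[X][Y]) :
    (partialX F).map ofPoly = Differential.mapCoeffs (F.map ofPoly) := by
  ext1 n
  rw [coeff_map, coeff_partialX, Differential.coeff_mapCoeffs, coeff_map, ← derivX_ofPoly]
  rfl

theorem lienardOp_map (f g : ℂ[X]) (F : ℂ[X][Y]) :
    lienardOp (ofPoly f) (ofPoly g) (F.map ofPoly) =
      (Y * partialX F - (C f * Y + C g) * derivative F).map ofPoly := by
  simp only [Polynomial.map_sub, Polynomial.map_mul, Polynomial.map_add, map_X, map_C,
    map_partialX, ← derivative_map, lienardOp]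

theorem lienardOp_C_mul {K : Type*} [CommRing K] [Differential K] (a b : K) {c : K}
    (hc : Differential.deriv c = 0) (F : K[X]) :
    lienardOp a b (C c * F) = C c * lienardOp a b F := by
  rw [lienardOp, lienardOp, mapCoeffs_mul, Differential.mapCoeffs_C, hc, derivative_C_mul, map_zero]
  ring

/-- An irreducible polynomial of positive degree in `y` stays separable over every field
containing `ℂ[x]`. -/
theorem separable_map_of_injective {K : Type*} [Field K] {φ : ℂ[X] →+* K}
    (hφ : Function.Injective φ) {F : ℂ[X][Y]} (hF : Irreducible F) (hdeg : F.natDegree ≠ 0) :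
    (F.map φ).Separable := by
  -- Gauss's lemma: `F` is primitive, hence irreducible over `ℂ(x)`, and characteristic zero gives
  -- separability.
  have h1 : (F.map (algebraMap ℂ[X] (FractionRing ℂ[X]))).Separable :=
    ((hF.isPrimitive hdeg).irreducible_iff_irreducible_map_fraction_map.1 hF).separable
  have h2 := h1.map (f := IsFractionRing.lift (K := FractionRing ℂ[X]) hφ)
  have h3 : (IsFractionRing.lift (K := FractionRing ℂ[X]) hφ).comp
      (algebraMap ℂ[X] (FractionRing ℂ[X])) = φ :=
    RingHom.ext fun x => IsFractionRing.lift_algebraMap hφ x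
  rwa [Polynomial.map_map, h3] at h2

theorem separable_map_ofPoly {F : ℂ[X][Y]} (hF : Irreducible F) (hdeg : F.natDegree ≠ 0) :
    (F.map ofPoly).Separable :=
  separable_map_of_injective ofPoly_injective hF hdeg

theorem polyPartCoeff_ofPoly (p : ℂ[X]) : polyPartCoeff (ofPoly p) = p := by
  ext n; rw [coeff_polyPartCoeff, coeff_ofPoly]

theorem polyPart_map_ofPoly (F : ℂ[X][Y]) : polyPart (F.map ofPoly) = F := by
  ext1 n
  rw [coeff_polyPart, coeff_map, polyPartCoeff_ofPoly]

/-- As `a ≠ 0`, `W` is already the image of a polynomial, so taking the polynomial part loses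
nothing. -/
theorem eq_C_mul_polyPart {F : ℂ[X][Y]} {W : SeriesAtInfinity[X]} {a : ℂ} (ha : a ≠ 0)
    (h : F.map ofPoly = C (ofPoly (C a)) * W) : F = C (C a) * polyPart W := by
  have h1 : W = (C (C a⁻¹) * F).map ofPoly := by
    rw [Polynomial.map_mul, h, map_C, ← mul_assoc, ← map_mul, ← map_mul, ← map_mul,
      inv_mul_cancel₀ ha]
    simp
  rw [h1, polyPart_map_ofPoly, ← mul_assoc, ← map_mul, ← map_mul, mul_inv_cancel₀ ha]
  simp

/-- The structure of the branches at infinity of an irreducible invariant curve. -/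
theorem exists_branches {f g q : ℂ[X]} {d : ℕ → ℂ} (hf : 1 ≤ f.natDegree)
    (hg : g.natDegree = f.natDegree + 1) (hq : IsLeadingPoly f q)
    (hq' : derivative q = C (slope f g) - f) (hd : IsOrbitSeries f g (seriesII f g d))
    {F : ℂ[X][Y]} (hF : Irreducible F) (hinv : IsLienardCurve f g F) :
    ∃ (n k : ℕ) (a : ℂ) (c : Fin n → ℕ → ℂ), 1 ≤ n + k ∧ (k = 0 ∨ k = 1) ∧ a ≠ 0 ∧
      F.map ofPoly = C (ofPoly (C a)) *
        branchProduct (fun j => seriesI q (c j)) (seriesII f g d) k ∧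
      (∀ j, IsOrbitSeries f g (seriesI q (c j))) ∧
      Function.Injective fun j => seriesI q (c j) := by
  obtain ⟨μ, w, hμ, hlc, hdeg, hop⟩ := hinv.exists_cofactor
  set z := seriesII f g d
  have hμ1 : ofPoly (C μ⁻¹) * ofPoly (C μ) = 1 := by
    rw [← map_mul, ← map_mul, inv_mul_cancel₀ hμ, map_one, map_one]
  have hmonic : (C (ofPoly (C μ⁻¹)) * F.map ofPoly).Monic := by
    apply monic_C_mul_of_mul_leadingCoeff_eq_one
    rw [leadingCoeff_map_of_injective ofPoly_injective, hlc, hμ1]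
  have hop' : lienardOp (ofPoly f) (ofPoly g) (C (ofPoly (C μ⁻¹)) * F.map ofPoly) =
      C (ofPoly w) * (C (ofPoly (C μ⁻¹)) * F.map ofPoly) := by
    rw [lienardOp_C_mul, lienardOp_map, hop, Polynomial.map_mul, map_C]
    · ring
    · change derivX _ = 0
      rw [ofPoly_C, derivX_C]
  obtain ⟨s, hs, hs'⟩ := exists_multiset_roots hf hg hq hq' hd hmonic hop'
  have hFs : F.map ofPoly = C (ofPoly (C μ)) * (s.map fun y => X - C y).prod := by
    rw [← hs, ← mul_assoc, ← map_mul, mul_comm (ofPoly (C μ)), hμ1, map_one, one_mul]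
  have hnodup : s.Nodup := by
    apply nodup_of_separable_prod
    have := separable_map_ofPoly hF hdeg
    rw [hFs] at this
    exact this.of_mul_right
  have hcard : 1 ≤ Multiset.card s := by
    rw [Nat.one_le_iff_ne_zero, Ne, Multiset.card_eq_zero]
    rintro rfl
    apply hdeg
    rw [← natDegree_map_eq_of_injective ofPoly_injective, hFs]
    simp
  -- The roots are distinct, so `z` occurs at most once; what remains is of type (I).
  obtain ⟨k, t, hk, hst, ht, hzt⟩ : ∃ (k : ℕ) (t : Multiset SeriesAtInfinity), (k = 0 ∨ k = 1) ∧
      s = t + Multiset.replicate k z ∧ t.Nodup ∧ z ∉ t := by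
    by_cases hz : z ∈ s
    · obtain ⟨t, rfl⟩ := Multiset.exists_cons_of_mem hz
      rw [Multiset.nodup_cons] at hnodup
      exact ⟨1, t, Or.inr rfl, by rw [Multiset.replicate_one, add_comm, Multiset.singleton_add],
        hnodup.2, hnodup.1⟩
    · exact ⟨0, s, Or.inl rfl, by simp, hnodup, hz⟩
  have htI : ∀ y ∈ t, ∃ c, y = seriesI q c ∧ IsOrbitSeries f g y := by
    intro y hy
    refine (hs' y (by rw [hst]; exact Multiset.mem_add.2 (Or.inl hy))).resolve_left ?_
    rintro rfl
    exact hzt hy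
  have htl : ∀ j : Fin t.toList.length, t.toList.get j ∈ t := fun j =>
    Multiset.mem_toList.1 (List.get_mem _ _)
  choose c hc hcO using fun j : Fin t.toList.length => htI _ (htl j)
  refine ⟨t.toList.length, k, μ, c, ?_, hk, hμ, ?_, fun j => hc j ▸ hcO j, ?_⟩
  · rw [hst, Multiset.card_add, Multiset.card_replicate] at hcard
    rwa [Multiset.length_toList]
  · rw [hFs, branchProduct, hst, Multiset.map_add, Multiset.prod_add, Multiset.map_replicate,
      Multiset.prod_replicate]
    congr 2
    simp only [← hc]
    conv_lhs => rw [← Multiset.coe_toList t, Multiset.map_coe, Multiset.prod_coe]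
    rw [← List.prod_ofFn]
    congr 1
    rw [← List.ofFn_get (t.toList.map fun y => X - C y)]
    simp [List.ofFn_eq_map]
  · simp only [← hc]
    rw [← List.nodup_iff_injective_get, ← Multiset.coe_nodup, Multiset.coe_toList]
    exact ht

end Lienard

theorem theorem1 (f g : ℂ[X]) (hf : 1 ≤ f.natDegree) (hg : g.natDegree = f.natDegree + 1) :
    -- the data below depend on `f` and `g` only
    ∃ (q : ℂ[X]) (d : ℕ → ℂ) (E : ℕ → ℂ[X]),
      Lienard.IsLeadingPoly f q ∧
      -- the coefficients of the series of type (II) are uniquely determined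
      (∀ d' : ℕ → ℂ, Lienard.IsOrbitSeries f g (Lienard.seriesII f g d') ↔ d' = d) ∧
      -- `q` and, up to the choice of `c 0`, the series of type (I) are uniquely determined
      (∀ (q' : ℂ[X]) (c : ℕ → ℂ), Lienard.IsLeadingPoly f q' →
        Lienard.IsOrbitSeries f g (Lienard.seriesI q' c) →
          q' = q ∧ ∀ n : ℕ, 1 ≤ n → c n = (E n).eval (c 0)) ∧
      -- the structure of the irreducible invariant algebraic curves
      ∀ F : ℂ[X][Y], Irreducible F → Lienard.IsLienardCurve f g F →
        ∃ (N k : ℕ) (a : ℂ) (c : Fin (N - k) → ℕ → ℂ),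
          1 ≤ N ∧ (k = 0 ∨ k = 1) ∧ a ≠ 0 ∧
          F = C (C a) * Lienard.polyPart (Lienard.branchProduct
            (fun j => Lienard.seriesI q (c j)) (Lienard.seriesII f g d) k) ∧
          -- the series are the branches of the curve at `x = ∞`
          F.map Lienard.ofPoly = C (Lienard.ofPoly (C a)) * Lienard.branchProduct
            (fun j => Lienard.seriesI q (c j)) (Lienard.seriesII f g d) k ∧
          (∀ j, Lienard.IsOrbitSeries f g (Lienard.seriesI q (c j))) ∧
          (Function.Injective fun j => c j 0) ∧
          (∀ j, ∀ n : ℕ, 1 ≤ n → c j n = (E n).eval (c j 0)) := by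
  obtain ⟨q, hq, hq'⟩ := Lienard.exists_isLeadingPoly hf (Lienard.slope f g)
  obtain ⟨d, hd⟩ := Lienard.exists_seriesII hf hg
  obtain ⟨E, hE, -⟩ := Lienard.exists_universal_tail hf hg hq hq'
  refine ⟨q, d, E, hq, hd, fun q' c hq'' hc => ?_, fun F hF hinv => ?_⟩
  · have h : q' = q :=
      hq''.eq_of_derivative_eq hq ((hq''.derivative_eq hf hg hc).trans hq'.symm)
    subst h
    exact ⟨rfl, hE c hc⟩
  · obtain ⟨n, k, a, c, hn, hk, ha, hFa, hc, hinj⟩ :=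
      Lienard.exists_branches hf hg hq hq' ((hd d).2 rfl) hF hinv
    obtain ⟨N, rfl, hN⟩ : ∃ N, n = N - k ∧ 1 ≤ N := ⟨n + k, by omega, hn⟩
    refine ⟨N, k, a, c, hN, hk, ha, Lienard.eq_C_mul_polyPart ha hFa, hFa, hc, fun i j hij => ?_,
      fun j => hE _ (hc j)⟩
    -- Equal `c 0` force equal tails through `E`, so distinct branches have distinct `c 0`.
    apply hinj
    have : c i = c j := by
      funext l
      rcases Nat.eq_zero_or_pos l with rfl | hl
      · exact hij
      · rw [hE _ (hc i) l hl, hE _ (hc j) l hl]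
        exact congrArg (fun x => (E l).eval x) hij
    simp only [this]
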